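/- Let $d\ge 2$ be an integer and, for a density $\rho>0$ and $N\in\mathbb N$, let $L_N:=(N/\rho)^{1/d}$ and $\Lambda_N:=(-L_N/2,L_N/2)^d\subset\mathbb R^d$. Let $\{x_j^\omega\}_j$ be a Poisson point process on $\mathbb R^d$ with intensity $\nu>0$ (with respect to Lebesgue measure), defined on a probability space $(\Omega,\Sigma,\mathbb P)$. For $R>0$, the vacancy set is $\Lambda_N^\omega:=\Lambda_N\setminus\bigcup_j\overline{B_R(x_j^\omega)}$. Put $s:=R/\sqrt d$ and consider the disjoint boxes $\prod_{i=1}^d[sj_i-\tfrac s2,\,sj_i+\tfrac s2)$, $j=(j_1,\dots,j_d)\in\mathbb Z^d$. Let $A_N^\omega$ be the largest number of these boxes that intersect one and the same connected component of $\Lambda_N^\omega$ (with $A_N^\omega:=0$ if $\Lambda_N^\omega=\emptyset$). For every $R>0$ there is a $\tilde\nu>0$ such that for every $\nu>\tilde\nu$ there are constants $\widetilde C_1,\widetilde C_2>0$ (depending only on $d$, $R$ and $\nu$) such that for every $\rho>0$ and every Poisson point process with intensity $\nu$ as above: 1. for every $C>\widetilde C_1$, $\displaystyle\lim_{N\to\infty}\mathbb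 P\big(A_N^\omega\le C\ln L_N\big)=1$; 2. for every $C'>\widetilde C_2$, $\mathbb P$-almost surely, $A_N^\omega\le C'\ln L_N$ for all but finitely many $N\in\mathbb N$. -/

import Mathlib

open MeasureTheory ProbabilityTheory Filter Topology Set

/-- The random set of points `X` is a (simple) Poisson point process on `ℝ^d` with intensity `ν`
with respect to Lebesgue measure: the number of points in each Borel set is a random variable,
it is Poisson distributed with mean `ν |B|` if `B` has finite volume, and the numbers of points in
pairwise disjoint Borel sets are mutually independent. -/
structure IsPoissonPointProcess {Ω : Type*} [MeasurableSpace Ω] (P : Measure Ω) {d : ℕ} (ν : ℝ)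
    (X : Ω → Set (EuclideanSpace ℝ (Fin d))) : Prop where
  measurable_count : ∀ B : Set (EuclideanSpace ℝ (Fin d)), MeasurableSet B →
    Measurable fun ω => (X ω ∩ B).encard
  map_count : ∀ B : Set (EuclideanSpace ℝ (Fin d)), MeasurableSet B → volume B ≠ ⊤ →
    P.map (fun ω => (X ω ∩ B).encard) =
      (poissonMeasure (ENNReal.ofReal ν * volume B).toNNReal).map (fun k : ℕ => (k : ℕ∞))
  iIndepFun_count : ∀ (ι : Type) (B : ι → Set (EuclideanSpace ℝ (Fin d))),
    (∀ i, MeasurableSet (B i)) → Pairwise (fun i j => Disjoint (B i) (B j)) →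
    iIndepFun (fun i ω => (X ω ∩ B i).encard) P

/-- The side length `L_N`, determined by `N / L_N ^ d = ρ`. -/
noncomputable def sideLength (d : ℕ) (ρ : ℝ) (N : ℕ) : ℝ :=
  ((N : ℝ) / ρ) ^ (1 / (d : ℝ))

/-- The open cube `(-L/2, L/2)^d`. -/
def openCube (d : ℕ) (L : ℝ) : Set (EuclideanSpace ℝ (Fin d)) :=
  {x | ∀ i, x i ∈ Ioo (-L / 2) (L / 2)}

/-- The vacancy set in the cube of side length `L`: what remains of the open cube after removal of
the closed Euclidean balls of radius `R` around the points in `S`. -/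
def vacancySet {d : ℕ} (L R : ℝ) (S : Set (EuclideanSpace ℝ (Fin d))) :
    Set (EuclideanSpace ℝ (Fin d)) :=
  openCube d L \ ⋃ x ∈ S, Metric.closedBall x R

/-- The half-open box of side length `s` centred at `s j`, for `j ∈ ℤ^d`. -/
def gridBox {d : ℕ} (s : ℝ) (j : Fin d → ℤ) : Set (EuclideanSpace ℝ (Fin d)) :=
  {x | ∀ i, x i ∈ Ico (s * (j i : ℝ) - s / 2) (s * (j i : ℝ) + s / 2)}

/-- The number of boxes of side length `s` that intersect the set `K`. -/
noncomputable def numBoxes {d : ℕ} (s : ℝ) (K : Set (EuclideanSpace ℝ (Fin d))) : ℕ∞ :=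
  {j : Fin d → ℤ | (gridBox s j ∩ K).Nonempty}.encard

/-- The largest number of boxes of side length `s = R / √d` that intersect one and the same
connected component of the vacancy set in the cube of side length `L`. -/
noncomputable def maxBoxes {d : ℕ} (L R : ℝ) (S : Set (EuclideanSpace ℝ (Fin d))) : ℕ∞ :=
  ⨆ x ∈ vacancySet L R S,
    numBoxes (R / Real.sqrt d) (connectedComponentIn (vacancySet L R S) x)

/-- The inequality `n ≤ r` between an extended natural number and a real number. -/
def ENatLeReal (n : ℕ∞) (r : ℝ) : Prop :=
  (((n : ENNReal)) : EReal) ≤ (r : EReal)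

/-! This is a Peierls argument. A box of side `s = R / √d` has diameter `R`, so a point of the
process in a box covers the whole box: boxes that meet the vacancy set are empty. The boxes met by
one component form a star-connected set (`starConnected_of_isPreconnected`), so if there are more
than `n` of them, a walk of `2 n` steps visits exactly `n + 1`, all empty
(`exists_walk_of_starConnected`).

There are at most `(2 M + 1) ^ d * 3 ^ (2 d n)` candidate walks, and each has empty boxes with
probability `exp (-ν s ^ d (n + 1))`. With `δ = ν s ^ d - 2 d log 3 > 0` and `n = ⌊C log L⌋`, the
union bound is of order `L ^ (d - δ C)`, that is, `N ^ (1 - δ C / d)`. It tends to `0` for `C > d /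
δ` and is summable for `C > 2 d / δ`, where Borel–Cantelli applies. -/

/-- The sites of `ℤ^d` at sup-distance at most one from `j`. -/
noncomputable def starNeighbors {d : ℕ} (j : Fin d → ℤ) : Finset (Fin d → ℤ) :=
  Fintype.piFinset fun i => Finset.Icc (j i - 1) (j i + 1)

theorem mem_starNeighbors {d : ℕ} {j k : Fin d → ℤ} :
    k ∈ starNeighbors j ↔ ∀ i, |k i - j i| ≤ 1 := by
  simp only [starNeighbors, Fintype.mem_piFinset, Finset.mem_Icc, abs_le]
  exact forall_congr' fun i => ⟨fun h => ⟨by linarith [h.1], by linarith [h.2]⟩,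
    fun h => ⟨by linarith [h.1], by linarith [h.2]⟩⟩

theorem mem_starNeighbors_comm {d : ℕ} {j k : Fin d → ℤ} :
    k ∈ starNeighbors j ↔ j ∈ starNeighbors k := by
  simp only [mem_starNeighbors, abs_sub_comm]

theorem card_starNeighbors {d : ℕ} (j : Fin d → ℤ) : (starNeighbors j).card = 3 ^ d := by
  have h : ∀ i, j i + 1 + 1 - (j i - 1) = 3 := fun i => by ring
  simp [starNeighbors, Fintype.card_piFinset, h]

open Classical in
/-- The walks with `m` steps that start at `v`, as lists of visited sites. -/
noncomputable def starWalks {d : ℕ} : ℕ → (Fin d → ℤ) → Finset (List (Fin d → ℤ))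
  | 0, v => {[v]}
  | m + 1, v => (starNeighbors v).biUnion fun u => (starWalks m u).image (List.cons v)

theorem card_starWalks_le {d : ℕ} (m : ℕ) (v : Fin d → ℤ) :
    (starWalks m v).card ≤ (3 ^ d) ^ m := by
  induction m generalizing v with
  | zero => simp [starWalks]
  | succ m ih =>
    rw [starWalks, pow_succ', ← card_starNeighbors v]
    refine Finset.card_biUnion_le_card_mul _ _ _ fun u _ => ?_
    rw [card_starNeighbors v]
    exact Finset.card_image_le.trans (ih u)

theorem cons_mem_starWalks {d : ℕ} (l : List (Fin d → ℤ)) (v : Fin d → ℤ)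
    (hl : (v :: l).IsChain fun a b => b ∈ starNeighbors a) : v :: l ∈ starWalks l.length v := by
  induction l generalizing v with
  | nil => simp [starWalks]
  | cons u l ih =>
    rw [List.isChain_cons_cons] at hl
    simp only [List.length_cons, starWalks, Finset.mem_biUnion, Finset.mem_image]
    exact ⟨u, hl.1, _, ih u hl.2, rfl⟩

open Classical in
/-- In a star-connected set of sites with at least `n + 1` elements there is a walk with `2 n` steps
that visits exactly `n + 1` sites. -/
theorem exists_walk_of_starConnected {d : ℕ} {J : Set (Fin d → ℤ)} {v : Fin d → ℤ} (hv : v ∈ J)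
    (hJ : ∀ T : Set (Fin d → ℤ), T ⊆ J → T.Nonempty → T ≠ J →
      ∃ t ∈ T, ∃ u ∈ J \ T, u ∈ starNeighbors t)
    (n : ℕ) (hn : ((n + 1 : ℕ) : ℕ∞) ≤ J.encard) :
    ∃ l ∈ starWalks (2 * n) v, l.toFinset.card = n + 1 ∧ ∀ j ∈ l, j ∈ J := by
  suffices h : ∃ l : List (Fin d → ℤ), (v :: l).IsChain (fun a b => b ∈ starNeighbors a) ∧
      l.length = 2 * n ∧ (v :: l).toFinset.card = n + 1 ∧ ∀ j ∈ v :: l, j ∈ J by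
    obtain ⟨l, h1, h2, h3, h4⟩ := h
    exact ⟨v :: l, h2 ▸ cons_mem_starWalks l v h1, h3, h4⟩
  induction n with
  | zero => exact ⟨[], by simp, by simp, by simp, by simpa using hv⟩
  | succ n ih =>
    obtain ⟨l, h1, h2, h3, h4⟩ := ih (le_trans (by exact_mod_cast Nat.le_succ _) hn)
    obtain ⟨t, ht, u, hu, htu⟩ := hJ (((v :: l).toFinset : Finset _) : Set (Fin d → ℤ))
      (fun j hj => h4 j (by simpa using hj)) ⟨v, by simp⟩ (by
        intro h
        rw [← h, Set.encard_coe_eq_coe_finsetCard, h3] at hn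
        have : n + 1 + 1 ≤ n + 1 := by exact_mod_cast hn
        omega)
    have ht' : t ∈ v :: l := by simpa using ht
    have hu' : u ∉ (v :: l).toFinset := by simpa using hu.2
    -- Splice the detour `t, u, t` into the walk at a visit to `t`: two more steps, one new site.
    obtain ⟨a, b, hab⟩ := List.append_of_mem ht'
    have hmem : ∀ j, j ∈ a ++ t :: u :: t :: b ↔ j = u ∨ j ∈ v :: l := by
      intro j; rw [hab]; simp only [List.mem_append, List.mem_cons]; tauto
    obtain ⟨l', hl'⟩ : ∃ l', a ++ t :: u :: t :: b = v :: l' := by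
      cases a with
      | nil => simp only [List.nil_append, List.cons.injEq] at hab; exact ⟨_, by rw [hab.1]; rfl⟩
      | cons x a =>
        simp only [List.cons_append, List.cons.injEq] at hab; exact ⟨_, by rw [hab.1]; rfl⟩
    refine ⟨l', ?_, ?_, ?_, ?_⟩
    · rw [← hl']
      rw [hab, List.isChain_split] at h1
      rw [List.isChain_split, List.isChain_cons_cons, List.isChain_cons_cons]
      exact ⟨h1.1, htu, mem_starNeighbors_comm.1 htu, h1.2⟩
    · have e1 := congrArg List.length hab
      have e2 := congrArg List.length hl'
      simp only [List.length_append, List.length_cons] at e1 e2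
      omega
    · have : (v :: l').toFinset = insert u (v :: l).toFinset := by
        ext j
        rw [List.mem_toFinset, ← hl', hmem, Finset.mem_insert, List.mem_toFinset]
      rw [this, Finset.card_insert_of_notMem hu', h3]
    · intro j hj
      rw [← hl', hmem] at hj
      rcases hj with rfl | hj
      · exact hu.1
      · exact h4 j hj

/-! ### Geometry of the boxes -/

theorem gridBox_iff {d : ℕ} {s : ℝ} (hs : 0 < s) (j : Fin d → ℤ) (x : EuclideanSpace ℝ (Fin d)) :
    x ∈ gridBox s j ↔ ∀ i, j i = ⌊x i / s + 1 / 2⌋ := by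
  refine forall_congr' fun i => ?_
  rw [eq_comm, Int.floor_eq_iff, mem_Ico, ← sub_le_iff_le_add, le_div_iff₀ hs,
    show x i / s + 1 / 2 < j i + 1 ↔ x i / s < j i + 1 / 2 from
      ⟨fun h => by linarith, fun h => by linarith⟩, div_lt_iff₀ hs]
  exact and_congr ⟨fun h => by linarith, fun h => by linarith⟩
    ⟨fun h => by linarith, fun h => by linarith⟩

theorem exists_mem_gridBox {d : ℕ} {s : ℝ} (hs : 0 < s) (x : EuclideanSpace ℝ (Fin d)) :
    ∃ j, x ∈ gridBox s j :=
  ⟨fun i => ⌊x i / s + 1 / 2⌋, (gridBox_iff hs _ x).2 fun _ => rfl⟩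

theorem pairwise_disjoint_gridBox {d : ℕ} {s : ℝ} (hs : 0 < s) :
    Pairwise fun j k : Fin d → ℤ => Disjoint (gridBox s j) (gridBox s k) := by
  intro j k hjk
  refine Set.disjoint_left.2 fun x hj hk => hjk (funext fun i => ?_)
  rw [(gridBox_iff hs j x).1 hj i, (gridBox_iff hs k x).1 hk i]

theorem measurableSet_gridBox {d : ℕ} (s : ℝ) (j : Fin d → ℤ) : MeasurableSet (gridBox s j) := by
  have : gridBox s j = ⋂ i, (fun x : EuclideanSpace ℝ (Fin d) => x i) ⁻¹'
      Ico (s * (j i : ℝ) - s / 2) (s * (j i : ℝ) + s / 2) := by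
    ext x; simp [gridBox]
  rw [this]
  exact MeasurableSet.iInter fun i =>
    (by fun_prop : Measurable fun x : EuclideanSpace ℝ (Fin d) => x i) measurableSet_Ico

theorem volume_gridBox {d : ℕ} (s : ℝ) (j : Fin d → ℤ) :
    volume (gridBox s j) = ENNReal.ofReal s ^ d := by
  have h := (EuclideanSpace.volume_preserving_symm_measurableEquiv_toLp (Fin d)).symm.measure_preimage
    (measurableSet_gridBox s j).nullMeasurableSet
  rw [← h]
  have : ((MeasurableEquiv.toLp 2 (Fin d → ℝ)).symm.symm ⁻¹' gridBox s j : Set (Fin d → ℝ)) =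
      Set.pi univ fun i => Ico (s * (j i : ℝ) - s / 2) (s * (j i : ℝ) + s / 2) := by
    ext x; simp [gridBox]
  rw [this, Real.volume_pi_Ico]
  simp

theorem dist_le_of_mem_gridBox {d : ℕ} {s : ℝ} {j : Fin d → ℤ}
    {x y : EuclideanSpace ℝ (Fin d)} (hs : 0 ≤ s) (hx : x ∈ gridBox s j) (hy : y ∈ gridBox s j) :
    dist x y ≤ Real.sqrt d * s := by
  rw [EuclideanSpace.dist_eq]
  calc Real.sqrt (∑ i, dist (x i) (y i) ^ 2) ≤ Real.sqrt (∑ _i : Fin d, s ^ 2) := by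
        refine Real.sqrt_le_sqrt (Finset.sum_le_sum fun i _ => ?_)
        refine pow_le_pow_left₀ dist_nonneg ?_ 2
        obtain ⟨h1, h2⟩ := hx i
        obtain ⟨h3, h4⟩ := hy i
        rw [Real.dist_eq, abs_le]
        constructor <;> linarith
    _ = Real.sqrt d * s := by
        rw [Finset.sum_const, Finset.card_univ, Fintype.card_fin, nsmul_eq_mul,
          Real.sqrt_mul (by positivity), Real.sqrt_sq hs]

/-- The set of boxes that meet a preconnected set is star-connected. -/
theorem starConnected_of_isPreconnected {d : ℕ} {s : ℝ} (hs : 0 < s)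
    {K : Set (EuclideanSpace ℝ (Fin d))} (hK : IsPreconnected K)
    (T : Set (Fin d → ℤ)) (hT : T ⊆ {j | (gridBox s j ∩ K).Nonempty}) (hne : T.Nonempty)
    (hTJ : T ≠ {j | (gridBox s j ∩ K).Nonempty}) :
    ∃ t ∈ T, ∃ u ∈ {j | (gridBox s j ∩ K).Nonempty} \ T, u ∈ starNeighbors t := by
  set J := {j : Fin d → ℤ | (gridBox s j ∩ K).Nonempty} with hJ
  -- `O t` is the open cube of side `2 s` about the centre of box `t`: large enough to contain the
  -- box, small enough to meet only boxes of star-neighbours.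
  let O : (Fin d → ℤ) → Set (EuclideanSpace ℝ (Fin d)) := fun t =>
    ⋂ i, {x | |x i - s * (t i : ℝ)| < s}
  have hO : ∀ t, IsOpen (O t) := fun t => isOpen_iInter_of_finite fun i =>
    isOpen_lt (by fun_prop) continuous_const
  have hsub : ∀ t, gridBox s t ⊆ O t := fun t x hx => by
    refine mem_iInter.2 fun i => ?_
    obtain ⟨h1, h2⟩ := hx i
    rw [Set.mem_ofPred_eq, abs_lt]
    constructor <;> linarith
  have hadj : ∀ t u x, x ∈ gridBox s u → x ∈ O t → u ∈ starNeighbors t := by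
    intro t u x hx ht
    rw [mem_starNeighbors]
    intro i
    obtain ⟨h1, h2⟩ := hx i
    have h3 := mem_iInter.1 ht i
    rw [Set.mem_ofPred_eq, abs_lt] at h3
    have h5 : s * ((u i : ℝ) - t i) < s * 2 := by linarith
    have h6 : s * (-2) < s * ((u i : ℝ) - t i) := by linarith
    have h7 := lt_of_mul_lt_mul_left h5 hs.le
    have h8 := lt_of_mul_lt_mul_left h6 hs.le
    have h9 : u i - t i < 2 := by exact_mod_cast h7
    have h10 : -2 < u i - t i := by exact_mod_cast h8
    rw [abs_le]; constructor <;> omega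
  obtain ⟨t₀, ht₀⟩ := hne
  obtain ⟨u₀, hu₀J, hu₀T⟩ : ∃ u, u ∈ J ∧ u ∉ T := by
    by_contra! h
    exact hTJ (hT.antisymm h)
  have hmem : ∀ x ∈ K, ∃ w ∈ J, x ∈ gridBox s w := fun x hx => by
    obtain ⟨w, hw⟩ := exists_mem_gridBox hs x
    exact ⟨w, ⟨x, hw, hx⟩, hw⟩
  obtain ⟨x, hxK, hx1, hx2⟩ := hK (⋃ t ∈ T, O t) (⋃ u ∈ J \ T, O u)
    (isOpen_biUnion fun t _ => hO t) (isOpen_biUnion fun t _ => hO t)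
    (fun x hx => by
      obtain ⟨w, hw, hxw⟩ := hmem x hx
      by_cases h : w ∈ T
      · exact Or.inl (mem_biUnion h (hsub w hxw))
      · exact Or.inr (mem_biUnion (show w ∈ J \ T from ⟨hw, h⟩) (hsub w hxw)))
    (by
      obtain ⟨x, hx, hxK⟩ := hT ht₀
      exact ⟨x, hxK, mem_biUnion ht₀ (hsub _ hx)⟩)
    (by
      have ⟨x, hx, hxK⟩ := hu₀J
      exact ⟨x, hxK, mem_biUnion (show u₀ ∈ J \ T from ⟨hu₀J, hu₀T⟩) (hsub _ hx)⟩)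
  obtain ⟨w, hw, hxw⟩ := hmem x hxK
  simp only [mem_iUnion, exists_prop] at hx1 hx2
  obtain ⟨t, ht, hxt⟩ := hx1
  obtain ⟨u, hu, hxu⟩ := hx2
  -- The box `w` of the common point is adjacent to both `t ∈ T` and `u ∉ T`, so it forms a crossing
  -- pair with one of them.
  by_cases h : w ∈ T
  · exact ⟨w, h, u, hu, mem_starNeighbors_comm.1 (hadj u w x hxw hxu)⟩
  · exact ⟨t, ht, w, ⟨hw, h⟩, hadj t w x hxw hxt⟩

/-! ### Probability of long empty walks -/

/-- The probability that finitely many boxes contain no point of the process. -/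
theorem IsPoissonPointProcess.measure_gridBox_empty {Ω : Type*} [MeasurableSpace Ω]
    {P : Measure Ω} {d : ℕ} {ν : ℝ} {X : Ω → Set (EuclideanSpace ℝ (Fin d))}
    (hX : IsPoissonPointProcess P ν X) (hν : 0 ≤ ν) {s : ℝ} (hs : 0 < s)
    (S : Finset (Fin d → ℤ)) :
    P {ω | ∀ j ∈ S, X ω ∩ gridBox s j = ∅} = ENNReal.ofReal (Real.exp (-(ν * s ^ d))) ^ S.card := by
  have h := (hX.iIndepFun_count (Fin d → ℤ) (gridBox s) (measurableSet_gridBox s)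
    (pairwise_disjoint_gridBox hs)).measure_inter_preimage_eq_mul S (sets := fun _ => {0})
    fun _ _ => measurableSet_singleton _
  have h1 : ∀ j : Fin d → ℤ, P ((fun ω => (X ω ∩ gridBox s j).encard) ⁻¹' {0}) =
      ENNReal.ofReal (Real.exp (-(ν * s ^ d))) := by
    intro j
    have hv : volume (gridBox s j) ≠ ⊤ := by rw [volume_gridBox]; finiteness
    rw [← Measure.map_apply (hX.measurable_count _ (measurableSet_gridBox s j))
      (measurableSet_singleton _), hX.map_count _ (measurableSet_gridBox s j) hv,
      Measure.map_apply (by fun_prop) (measurableSet_singleton _)]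
    have : ((fun k : ℕ => (k : ℕ∞)) ⁻¹' {0}) = {0} := by ext k; simp
    rw [this, poissonMeasure_singleton, volume_gridBox]
    simp [ENNReal.coe_toNNReal_eq_toReal, ENNReal.toReal_ofReal hν, ENNReal.toReal_ofReal hs.le]
  simp only [h1, Finset.prod_const] at h
  rw [← h]
  congr 1
  ext ω
  simp

/-- The sites whose coordinates are at most `M` in absolute value. -/
noncomputable def siteCube (d M : ℕ) : Finset (Fin d → ℤ) :=
  Fintype.piFinset fun _ => Finset.Icc (-(M : ℤ)) M

theorem card_siteCube (d M : ℕ) : (siteCube d M).card = (2 * M + 1) ^ d := by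
  have h : ((M : ℤ) + 1 + M).toNat = 2 * M + 1 := by omega
  simp [siteCube, Fintype.card_piFinset, h]

theorem mem_siteCube_of_mem_openCube {d M : ℕ} {s L : ℝ} (hs : 0 < s) (hM : L / (2 * s) + 1 / 2 ≤ M)
    {j : Fin d → ℤ} {x : EuclideanSpace ℝ (Fin d)} (hj : x ∈ gridBox s j) (hx : x ∈ openCube d L) :
    j ∈ siteCube d M := by
  rw [siteCube, Fintype.mem_piFinset]
  intro i
  obtain ⟨h1, h2⟩ := hj i
  obtain ⟨h3, h4⟩ := hx i
  have h5 : L / 2 + s / 2 ≤ s * M := by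
    calc L / 2 + s / 2 = s * (L / (2 * s) + 1 / 2) := by field_simp
      _ ≤ s * M := by gcongr
  have h6 : s * (j i : ℝ) ≤ s * M := by linarith
  have h7 : s * (-(M : ℝ)) ≤ s * (j i : ℝ) := by linarith
  rw [Finset.mem_Icc]
  exact ⟨by exact_mod_cast le_of_mul_le_mul_left h7 hs,
    by exact_mod_cast le_of_mul_le_mul_left h6 hs⟩

/-- The event that some walk with `2 n` steps from the cube of sites visits `n + 1` distinct
boxes, none of which contains a point. -/
def emptyWalkEvent {Ω : Type*} {d : ℕ} (X : Ω → Set (EuclideanSpace ℝ (Fin d))) (s : ℝ)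
    (M n : ℕ) : Set Ω :=
  {ω | ∃ v ∈ siteCube d M, ∃ l ∈ starWalks (2 * n) v, l.toFinset.card = n + 1 ∧
    ∀ j ∈ l.toFinset, X ω ∩ gridBox s j = ∅}

/-- Union bound over starting sites and walks; the exponent `n + 1` counts distinct boxes, since
revisits cost no probability. -/
theorem IsPoissonPointProcess.measure_emptyWalkEvent_le {Ω : Type*} [MeasurableSpace Ω]
    {P : Measure Ω} {d : ℕ} {ν : ℝ} {X : Ω → Set (EuclideanSpace ℝ (Fin d))}
    (hX : IsPoissonPointProcess P ν X) (hν : 0 ≤ ν) {s : ℝ} (hs : 0 < s) (M n : ℕ) :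
    P (emptyWalkEvent X s M n) ≤ ENNReal.ofReal
      ((2 * M + 1) ^ d * ((3 ^ d) ^ (2 * n) * Real.exp (-(ν * s ^ d)) ^ (n + 1))) := by
  have hsub : emptyWalkEvent X s M n ⊆ ⋃ v ∈ siteCube d M,
      ⋃ l ∈ (starWalks (2 * n) v).filter fun l => l.toFinset.card = n + 1,
        {ω | ∀ j ∈ l.toFinset, X ω ∩ gridBox s j = ∅} := by
    rintro ω ⟨v, hv, l, hl, hc, h⟩
    simp only [mem_iUnion, Finset.mem_filter, exists_prop]
    exact ⟨v, hv, l, ⟨hl, hc⟩, h⟩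
  set q := ENNReal.ofReal (Real.exp (-(ν * s ^ d))) with hq
  calc P (emptyWalkEvent X s M n)
      ≤ ∑ v ∈ siteCube d M, ∑ l ∈ (starWalks (2 * n) v).filter fun l => l.toFinset.card = n + 1,
        P {ω | ∀ j ∈ l.toFinset, X ω ∩ gridBox s j = ∅} :=
        (measure_mono hsub).trans ((measure_biUnion_finset_le _ _).trans
          (Finset.sum_le_sum fun v _ => measure_biUnion_finset_le _ _))
    _ ≤ ∑ v ∈ siteCube d M, ((3 ^ d) ^ (2 * n) : ℕ) * q ^ (n + 1) := by
        refine Finset.sum_le_sum fun v _ => ?_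
        have : ∀ l ∈ (starWalks (2 * n) v).filter fun l => l.toFinset.card = n + 1,
            P {ω | ∀ j ∈ l.toFinset, X ω ∩ gridBox s j = ∅} = q ^ (n + 1) := fun l hl => by
          rw [hX.measure_gridBox_empty hν hs, (Finset.mem_filter.1 hl).2]
        rw [Finset.sum_congr rfl this, Finset.sum_const, nsmul_eq_mul]
        gcongr
        exact (Finset.card_filter_le _ _).trans (card_starWalks_le _ _)
    _ = _ := by
        rw [Finset.sum_const, nsmul_eq_mul, card_siteCube, hq,
          ENNReal.ofReal_mul (by positivity), ENNReal.ofReal_mul (by positivity),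
          ENNReal.ofReal_pow (Real.exp_pos _).le, ← ENNReal.ofReal_natCast,
          ← ENNReal.ofReal_natCast]
        push_cast
        rfl

/-! ### From large components to the tail bound -/

theorem ENatLeReal_iff {m : ℕ∞} {r : ℝ} (hr : 0 ≤ r) : ENatLeReal m r ↔ m ≤ (⌊r⌋₊ : ℕ∞) := by
  unfold ENatLeReal
  induction m using ENat.recTopCoe with
  | top => simp
  | coe k =>
    have : (((k : ℕ∞) : ENNReal) : EReal) = ((k : ℝ) : EReal) := by
      rw [ENat.toENNReal_coe]; rfl
    rw [this, EReal.coe_le_coe_iff, Nat.cast_le, Nat.le_floor_iff hr]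

/-- If some component of the vacancy set meets more than `r` boxes, then there is a walk through
more than `r` empty boxes. -/
theorem mem_emptyWalkEvent_of_not_ENatLeReal {Ω : Type*} {d : ℕ} (hd : 0 < d) {R L r : ℝ}
    (hR : 0 < R) (hr : 0 ≤ r) {X : Ω → Set (EuclideanSpace ℝ (Fin d))} {M : ℕ}
    (hM : L / (2 * (R / Real.sqrt d)) + 1 / 2 ≤ M) {ω : Ω}
    (h : ¬ ENatLeReal (maxBoxes L R (X ω)) r) :
    ω ∈ emptyWalkEvent X (R / Real.sqrt d) M ⌊r⌋₊ := by
  have hd' : 0 < Real.sqrt d := Real.sqrt_pos.2 (by exact_mod_cast hd)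
  set s := R / Real.sqrt d with hs_def
  have hs : 0 < s := by positivity
  have hsR : Real.sqrt d * s = R := by rw [hs_def]; field_simp
  rw [ENatLeReal_iff hr, maxBoxes, iSup₂_le_iff] at h
  push Not at h
  obtain ⟨x, hx, hlt⟩ := h
  set K := connectedComponentIn (vacancySet L R (X ω)) x
  have hKV : K ⊆ vacancySet L R (X ω) := connectedComponentIn_subset _ _
  obtain ⟨v, hv⟩ := exists_mem_gridBox hs x
  obtain ⟨l, hl, hcard, hlJ⟩ := exists_walk_of_starConnected
    (J := {j | (gridBox s j ∩ K).Nonempty}) (v := v) ⟨x, hv, mem_connectedComponentIn hx⟩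
    (starConnected_of_isPreconnected hs isPreconnected_connectedComponentIn) ⌊r⌋₊
    (by rw [Nat.cast_add_one]; exact Order.add_one_le_of_lt hlt)
  refine ⟨v, mem_siteCube_of_mem_openCube hs hM hv hx.1, l, hl, ?_, ?_⟩
  · convert hcard
  · intro j hj
    rw [List.mem_toFinset] at hj
    obtain ⟨y, hyj, hyK⟩ := hlJ j hj
    -- A point `p` in box `j` would lie within `R` of the vacant point `y`.
    refine Set.eq_empty_of_forall_notMem fun p hp => (hKV hyK).2 ?_
    exact mem_biUnion hp.1 (Metric.mem_closedBall.2
      ((dist_le_of_mem_gridBox hs.le hyj hp.2).trans_eq hsR))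

theorem IsPoissonPointProcess.measure_not_maxBoxes_le {Ω : Type*} [MeasurableSpace Ω]
    {P : Measure Ω} {d : ℕ} (hd : 0 < d) {ν R L C δ : ℝ}
    {X : Ω → Set (EuclideanSpace ℝ (Fin d))} (hX : IsPoissonPointProcess P ν X) (hν : 0 ≤ ν)
    (hR : 0 < R) (hL : 1 ≤ L) (hC : 0 ≤ C) (hδ : 0 ≤ δ)
    (hδν : δ = ν * (R / Real.sqrt d) ^ d - 2 * d * Real.log 3) :
    P {ω | ¬ ENatLeReal (maxBoxes L R (X ω)) (C * Real.log L)} ≤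
      ENNReal.ofReal ((1 / (R / Real.sqrt d) + 4) ^ d * L ^ (d - δ * C)) := by
  have hd' : 0 < Real.sqrt d := Real.sqrt_pos.2 (by exact_mod_cast hd)
  have hs : 0 < R / Real.sqrt d := by positivity
  set s := R / Real.sqrt d
  have hL0 : 0 < L := by linarith
  have hlog : 0 ≤ Real.log L := Real.log_nonneg hL
  have hr : 0 ≤ C * Real.log L := by positivity
  set M := ⌈L / (2 * s) + 1 / 2⌉₊
  set n := ⌊C * Real.log L⌋₊
  have hn : C * Real.log L ≤ n + 1 := (Nat.lt_floor_add_one _).le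
  refine (measure_mono fun ω hω => mem_emptyWalkEvent_of_not_ENatLeReal hd hR hr
    (Nat.le_ceil _) hω).trans ((hX.measure_emptyWalkEvent_le hν hs M n).trans
    (ENNReal.ofReal_le_ofReal ?_))
  -- Rounding up gives `2 M + 1 < L / s + 4`; then `1 ≤ L` absorbs the constant.
  have hM : (2 * M + 1 : ℝ) ≤ (1 / s + 4) * L := by
    have h1 : (M : ℝ) < L / (2 * s) + 1 / 2 + 1 := Nat.ceil_lt_add_one (by positivity)
    have h2 : 2 * (L / (2 * s)) = 1 / s * L := by field_simp
    linarith
  have hexp : ((3 : ℝ) ^ d) ^ (2 * n) * Real.exp (-(ν * s ^ d)) ^ (n + 1) ≤ L ^ (-(δ * C)) := by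
    have h3 : ((3 : ℝ) ^ d) ^ (2 * n) = Real.exp (2 * d * Real.log 3 * n) := by
      rw [← pow_mul, show 2 * (d : ℝ) * Real.log 3 * n = ((d * (2 * n) : ℕ) : ℝ) * Real.log 3 by
        push_cast; ring, Real.exp_nat_mul, Real.exp_log (by norm_num)]
    have h4 : 0 ≤ 2 * d * Real.log 3 := by positivity
    rw [h3, ← Real.exp_nat_mul, ← Real.exp_add, Real.rpow_def_of_pos hL0, Real.exp_le_exp]
    -- The exponent is at most `-δ (n + 1)`, which `hn` bounds by `-δ C log L`.
    have h5 := mul_le_mul_of_nonneg_left hn hδ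
    rw [show ν * s ^ d = δ + 2 * d * Real.log 3 by rw [hδν]; ring]
    push_cast
    linarith
  calc ((2 * M + 1 : ℝ)) ^ d * (((3 : ℝ) ^ d) ^ (2 * n) * Real.exp (-(ν * s ^ d)) ^ (n + 1))
      ≤ ((1 / s + 4) * L) ^ d * L ^ (-(δ * C)) := by gcongr
    _ = (1 / s + 4) ^ d * L ^ (d - δ * C) := by
        rw [mul_pow, mul_assoc, sub_eq_add_neg, Real.rpow_add hL0, Real.rpow_natCast]

/-! ### Asymptotics in `N` -/

theorem eventually_one_le_sideLength {d : ℕ} (hd : 0 < d) {ρ : ℝ} (hρ : 0 < ρ) :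
    ∀ᶠ N : ℕ in atTop, 1 ≤ sideLength d ρ N := by
  filter_upwards [eventually_ge_atTop ⌈ρ⌉₊] with N hN
  have : ρ ≤ N := (Nat.le_ceil ρ).trans (by exact_mod_cast hN)
  exact Real.one_le_rpow ((one_le_div hρ).2 this) (by positivity)

theorem sideLength_rpow {d : ℕ} (hd : 0 < d) {ρ : ℝ} (hρ : 0 < ρ) (N : ℕ) (a : ℝ) :
    sideLength d ρ N ^ (d - a) = ρ⁻¹ ^ (1 - a / d) * (N : ℝ) ^ (1 - a / d) := by
  have hd' : (d : ℝ) ≠ 0 := by positivity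
  rw [sideLength, ← Real.rpow_mul (by positivity), mul_comm (_ ^ _),
    ← Real.mul_rpow (by positivity) (by positivity), div_eq_mul_inv (N : ℝ)]
  congr 1
  field_simp

theorem theorem3p1 (d : ℕ) (hd : 2 ≤ d) (R : ℝ) (hR : 0 < R) :
    ∃ ν₀ : ℝ, 0 < ν₀ ∧ ∀ ν : ℝ, ν₀ < ν →
      ∃ C₁ C₂ : ℝ, 0 < C₁ ∧ 0 < C₂ ∧
        ∀ (ρ : ℝ), 0 < ρ →
        ∀ (Ω : Type*) [MeasurableSpace Ω] (P : Measure Ω) [IsProbabilityMeasure P]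
          (X : Ω → Set (EuclideanSpace ℝ (Fin d))), IsPoissonPointProcess P ν X →
          (∀ C : ℝ, C₁ < C →
            Tendsto (fun N : ℕ => P {ω | ENatLeReal (maxBoxes (sideLength d ρ N) R (X ω))
              (C * Real.log (sideLength d ρ N))}) atTop (𝓝 1)) ∧
          (∀ C' : ℝ, C₂ < C' →
            ∀ᵐ ω ∂P, ∀ᶠ N : ℕ in atTop, ENatLeReal (maxBoxes (sideLength d ρ N) R (X ω))
              (C' * Real.log (sideLength d ρ N))) := by
  have hd0 : 0 < d := by omega
  have hdR : (0 : ℝ) < d := by exact_mod_cast hd0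
  have hs : 0 < R / Real.sqrt d := by positivity
  have hlog3 : 0 < Real.log 3 := Real.log_pos (by norm_num)
  -- The threshold is the intensity at which `δ` vanishes.
  refine ⟨2 * d * Real.log 3 / (R / Real.sqrt d) ^ d, by positivity, fun ν hν => ?_⟩
  have hν0 : 0 < ν := lt_trans (by positivity) hν
  obtain ⟨δ, hδν⟩ : ∃ δ, δ = ν * (R / Real.sqrt d) ^ d - 2 * d * Real.log 3 := ⟨_, rfl⟩
  have hδ : 0 < δ := by
    rw [div_lt_iff₀ (by positivity)] at hν
    linarith
  refine ⟨d / δ, 2 * d / δ, by positivity, by positivity, fun ρ hρ Ω _ P _ X hX => ?_⟩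
  obtain ⟨A, hA⟩ : ∃ A, A = (1 / (R / Real.sqrt d) + 4) ^ d := ⟨_, rfl⟩
  have hbound : ∀ C : ℝ, 0 ≤ C → ∀ᶠ N : ℕ in atTop,
      P {ω | ¬ ENatLeReal (maxBoxes (sideLength d ρ N) R (X ω))
        (C * Real.log (sideLength d ρ N))} ≤
      ENNReal.ofReal (A * (ρ⁻¹ ^ (1 - δ * C / d) * (N : ℝ) ^ (1 - δ * C / d))) := fun C hC => by
    filter_upwards [eventually_one_le_sideLength hd0 hρ] with N hN
    rw [← sideLength_rpow hd0 hρ, hA]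
    exact hX.measure_not_maxBoxes_le hd0 hν0.le hR hN hC hδ.le hδν
  refine ⟨fun C hC => ?_, fun C hC => ?_⟩
  · have hC0 : 0 < C := lt_trans (by positivity) hC
    have hexp : 0 < δ * C / d - 1 := by
      rw [div_lt_iff₀ hδ] at hC
      rw [sub_pos, lt_div_iff₀ hdR]
      linarith
    have hlim : Tendsto (fun N : ℕ => ENNReal.ofReal
        (A * (ρ⁻¹ ^ (1 - δ * C / d) * (N : ℝ) ^ (1 - δ * C / d)))) atTop (𝓝 0) := by
      have h := (((tendsto_rpow_neg_atTop hexp).comp tendsto_natCast_atTop_atTop).const_mul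
        (ρ⁻¹ ^ (1 - δ * C / d))).const_mul A
      simpa [Function.comp_def] using ENNReal.tendsto_ofReal h
    have hbad := tendsto_of_tendsto_of_tendsto_of_le_of_le' tendsto_const_nhds hlim
      (Eventually.of_forall fun _ => zero_le) (hbound C hC0.le)
    have hsub := ENNReal.Tendsto.sub (tendsto_const_nhds (x := (1 : ENNReal))) hbad
      (Or.inl ENNReal.one_ne_top)
    rw [tsub_zero] at hsub
    refine tendsto_of_tendsto_of_tendsto_of_le_of_le hsub tendsto_const_nhds (fun N => ?_)
      fun N => prob_le_one
    -- Subadditivity over the event and its complement avoids any measurability of the event.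
    rw [tsub_le_iff_right, ← measure_univ (μ := P)]
    refine (measure_mono fun ω _ => ?_).trans (measure_union_le _ _)
    exact Classical.em _
  · have hC0 : 0 < C := lt_trans (by positivity) hC
    have hexp : 1 - δ * C / d < -1 := by
      rw [div_lt_iff₀ hδ] at hC
      have : 2 < δ * C / d := by rw [lt_div_iff₀ hdR]; linarith
      linarith
    obtain ⟨N₀, hN₀⟩ := eventually_atTop.1 (hbound C hC0.le)
    have hsum := (((Real.summable_nat_rpow.2 hexp).mul_left (ρ⁻¹ ^ (1 - δ * C / d))).mul_left A)
    -- Borel–Cantelli is applied from `N₀` on, where the tail bound holds.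
    have hae := ae_eventually_notMem (μ := P) (s := fun N =>
      {ω | ¬ ENatLeReal (maxBoxes (sideLength d ρ (N + N₀)) R (X ω))
        (C * Real.log (sideLength d ρ (N + N₀)))}) (ne_top_of_le_ne_top
      ((summable_nat_add_iff N₀).2 hsum).tsum_ofReal_ne_top
      (ENNReal.tsum_le_tsum fun N => hN₀ (N + N₀) (Nat.le_add_left _ _)))
    filter_upwards [hae] with ω hω
    rw [← map_add_atTop_eq_nat N₀, eventually_map]
    exact hω.mono fun N hN => not_not.1 hN
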